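/- Let $1\le p<\infty$ and let $X=(X,d,\mu)$ be a metric space equipped with a Borel measure $\mu$ (completed) such that $0<\mu(B)<\infty$ for all balls $B$. Write $B(x,r)=\{y:d(x,y)<r\}$, fix $x_0\in X$ and write $B_r=B(x_0,r)$. Definitions. Curves are nonconstant, compact and rectifiable, and are parametrized by arc length. A Borel function $g:X\to[0,\infty]$ is an upper gradient of $f:X\to[-\infty,\infty]$ if $|f(\gamma(0))-f(\gamma(l_\gamma))|\le\int_\gamma g\,ds$ for all curves $\gamma:[0,l_\gamma]\to X$, where the left-hand side is $\infty$ if one of its terms is infinite; a measurable $g$ is a $p$-weak upper gradient of $f$ if this holds for all curves outside a family $\Gamma$ for which there is a Borel function $0\le\rho\in L^p(X)$ with $\int_\gamma\rho\,ds=\infty$ for all $\gamma\in\Gamma$. The Newtonian space $N^{1,p}(X)$ consists of the measurable (everywhere defined) $f:X\to[-\infty,\infty]$ with $\int_X|f|^p\,d\mu+\inf_g\int_X g^p\,d\mu<\infty$, the infimum being over all upper gradients $g$ of $f$; $g_f\in L^p(X)$ denotes the minimal $p$-weak upper gradient of $f$. For $E\subset\Omega$ with $\Omega$ open, $$\operatorname{cap}_p(E,\Omega)=\inf_u\int_\Omega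 g_u^p\,d\mu,$$ the infimum being over all $u\in N^{1,p}(X)$ with $\chi_E\le u\le1$ in $\Omega$ and $u=0$ on $X\setminus\Omega$. $X$ supports a $p$-Poincaré inequality at $x$ with constants $C_P>0$ and $\lambda\ge1$ if, for all $r>0$, all integrable $f:X\to[-\infty,\infty]$ and all upper gradients $g$ of $f$, with $B=B(x,r)$, $\lambda B=B(x,\lambda r)$ and $f_B=\mu(B)^{-1}\int_B f\,d\mu$, $$\frac1{\mu(B)}\int_B|f-f_B|\,d\mu\le C_P\,r\Bigl(\frac1{\mu(\lambda B)}\int_{\lambda B}g^p\,d\mu\Bigr)^{1/p}.$$ $\mu$ is doubling at $x$ with constant $C_D>0$ if $\mu(B(x,2r))\le C_D\,\mu(B(x,r))$ for all $r>0$. $\mu$ is reverse-doubling at $x$ with dilation $\tau>1$ and constant $\gamma>1$ if $\mu(B(x,\tau r))\ge\gamma\,\mu(B(x,r))$ for all $0<r\le\operatorname{diam}X/(2\tau)$. The first two conditions hold globally if they hold at every $x\in X$ with constants independent of $x$. Proposition. (a) Assume that $X$ supports a $p$-Poincaré inequality at $x_0$, that $\mu$ is doubling at $x_0$, and that $\mu$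 is reverse-doubling at $x_0$ with dilation $\tau>1$. Then there is a constant $A>0$, depending only on $p$, $C_P$, $\lambda$, $C_D$, $\gamma$ and $\tau$, such that $$\frac{\mu(B_R)}{R^p}\le A\operatorname{cap}_p(B_r,B_R)\qquad\text{whenever } 0<\frac R2\le r<R\le\frac{\operatorname{diam}X}{2\tau},$$ and $$\frac1A\,\frac{\mu(B_r)}{r^p}\le\operatorname{cap}_p(B_r,B_{2r})\le A\,\frac{\mu(B_r)}{r^p}\qquad\text{whenever } 0<r\le\frac{\operatorname{diam}X}{4\tau}.$$ (b) If $\mu$ is globally doubling and $X$ supports a global $p$-Poincaré inequality, then for every $\tau>1$ both estimates hold, in the same ranges, with a constant $A>0$ that is independent of $x_0\in X$ and depends only on $p$, $C_P$, $\lambda$, $C_D$ and $\tau$. -/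

import Mathlib

open MeasureTheory Set Metric
open scoped ENNReal

namespace MetricCapacity

noncomputable section

/-- A nonconstant compact rectifiable curve, parametrized by arc length on `[0, length]`.
The values of `toFun` outside `[0, length]` are irrelevant. -/
structure ArcCurve (X : Type*) [MetricSpace X] where
  length : ℝ
  length_pos : 0 < length
  toFun : ℝ → X
  unitSpeed : HasUnitSpeedOn toFun (Icc 0 length)

/-- The line integral of `g` along `γ` with respect to arc length. -/
def lineIntegral {X : Type*} [MetricSpace X] (g : X → ℝ≥0∞) (γ : ArcCurve X) : ℝ≥0∞ :=
  ∫⁻ s in Icc 0 γ.length, g (γ.toFun s)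

/-- The upper gradient inequality along one curve. In `EReal` a difference with an infinite term
is infinite (also `⊤ - ⊤ = ⊥`), so the left-hand side is `∞` as soon as one of the two values is
infinite. -/
def UpperGradientOn {X : Type*} [MetricSpace X] (f : X → EReal) (g : X → ℝ≥0∞)
    (γ : ArcCurve X) : Prop :=
  (f (γ.toFun 0) - f (γ.toFun γ.length)).abs ≤ lineIntegral g γ

/-- `g` is a (Borel) upper gradient of `f`. -/
def IsUpperGradient {X : Type*} [MetricSpace X] [MeasurableSpace X]
    (f : X → EReal) (g : X → ℝ≥0∞) : Prop :=
  Measurable g ∧ ∀ γ : ArcCurve X, UpperGradientOn f g γ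

/-- The curve family `Γ` has zero `p`-modulus. -/
def ZeroModulus {X : Type*} [MetricSpace X] [MeasurableSpace X] (p : ℝ) (μ : Measure X)
    (Γ : Set (ArcCurve X)) : Prop :=
  ∃ ρ : X → ℝ≥0∞, Measurable ρ ∧ ∫⁻ x, ρ x ^ p ∂μ < ∞ ∧ ∀ γ ∈ Γ, lineIntegral ρ γ = ∞

/-- `g` is a `p`-weak upper gradient of `f`. Measurability is with respect to the completion
of `μ`. -/
def IsWeakUpperGradient {X : Type*} [MetricSpace X] [MeasurableSpace X] (p : ℝ) (μ : Measure X)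
    (f : X → EReal) (g : X → ℝ≥0∞) : Prop :=
  AEMeasurable g μ ∧ ZeroModulus p μ {γ | ¬ UpperGradientOn f g γ}

/-- The Newtonian (Sobolev) norm. -/
def newtonianNorm {X : Type*} [MetricSpace X] [MeasurableSpace X] (p : ℝ) (μ : Measure X)
    (f : X → EReal) : ℝ≥0∞ :=
  (∫⁻ x, (f x).abs ^ p ∂μ +
    ⨅ (g : X → ℝ≥0∞) (_ : IsUpperGradient f g), ∫⁻ x, g x ^ p ∂μ) ^ (1 / p)

/-- `f` belongs to the Newtonian space `N^{1,p}(X)`. -/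
def MemNewtonian {X : Type*} [MetricSpace X] [MeasurableSpace X] (p : ℝ) (μ : Measure X)
    (f : X → EReal) : Prop :=
  AEMeasurable f μ ∧ newtonianNorm p μ f < ∞

/-- `g` is the minimal `p`-weak upper gradient of `f`: it is a `p`-weak upper gradient in `L^p`
lying a.e. below all others. -/
def IsMinimalWeakUpperGradient {X : Type*} [MetricSpace X] [MeasurableSpace X] (p : ℝ)
    (μ : Measure X) (f : X → EReal) (g : X → ℝ≥0∞) : Prop :=
  (IsWeakUpperGradient p μ f g ∧ ∫⁻ x, g x ^ p ∂μ < ∞) ∧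
    ∀ h : X → ℝ≥0∞, IsWeakUpperGradient p μ f h → ∫⁻ x, h x ^ p ∂μ < ∞ → g ≤ᵐ[μ] h

/-- The energy `∫_Ω g_u^p dμ` of `u` in `Ω`, as the least value of `∫_Ω g^p dμ` over all `p`-weak
upper gradients `g ∈ L^p(X)` of `u`; it is attained by the minimal `p`-weak upper gradient `g_u`
(see `energy_eq`). -/
def energy {X : Type*} [MetricSpace X] [MeasurableSpace X] (p : ℝ) (μ : Measure X)
    (Ω : Set X) (u : X → EReal) : ℝ≥0∞ :=
  ⨅ (g : X → ℝ≥0∞) (_ : IsWeakUpperGradient p μ u g ∧ ∫⁻ x, g x ^ p ∂μ < ∞),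
    ∫⁻ x in Ω, g x ^ p ∂μ

theorem energy_eq {X : Type*} [MetricSpace X] [MeasurableSpace X] {p : ℝ} (hp : 0 ≤ p)
    {μ : Measure X} (Ω : Set X) {u : X → EReal} {g : X → ℝ≥0∞}
    (hg : IsMinimalWeakUpperGradient p μ u g) :
    energy p μ Ω u = ∫⁻ x in Ω, g x ^ p ∂μ := by
  refine le_antisymm (iInf₂_le g hg.1) (le_iInf₂ fun h hh => ?_)
  refine lintegral_mono_ae (ae_restrict_of_ae ?_)
  filter_upwards [hg.2 h hh.1 hh.2] with x hx
  exact ENNReal.rpow_le_rpow hx hp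

/-- `u` is admissible for the variational capacity of `E` with respect to `Ω`. -/
def Admissible {X : Type*} [MetricSpace X] [MeasurableSpace X] (p : ℝ) (μ : Measure X)
    (E Ω : Set X) (u : X → EReal) : Prop :=
  MemNewtonian p μ u ∧ (∀ x ∈ Ω, E.indicator 1 x ≤ u x ∧ u x ≤ 1) ∧ ∀ x ∉ Ω, u x = 0

/-- The variational `p`-capacity of `E` with respect to `Ω`. -/
def capacity {X : Type*} [MetricSpace X] [MeasurableSpace X] (p : ℝ) (μ : Measure X)
    (E Ω : Set X) : ℝ≥0∞ :=
  ⨅ (u : X → EReal) (_ : Admissible p μ E Ω u), energy p μ Ω u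

/-- All balls have positive and finite measure. -/
def BallsPosFinite {X : Type*} [MetricSpace X] [MeasurableSpace X] (μ : Measure X) : Prop :=
  ∀ (x : X) (r : ℝ), 0 < r → 0 < μ (ball x r) ∧ μ (ball x r) < ∞

/-- `μ` is doubling at `x` with constant `C`. -/
def DoublingAt {X : Type*} [MetricSpace X] [MeasurableSpace X] (C : ℝ) (μ : Measure X)
    (x : X) : Prop :=
  ∀ r : ℝ, 0 < r → μ (ball x (2 * r)) ≤ ENNReal.ofReal C * μ (ball x r)

/-- `μ` is reverse-doubling at `x` with constant `γ` and dilation `τ`. -/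
def ReverseDoublingAt {X : Type*} [MetricSpace X] [MeasurableSpace X] (γ τ : ℝ) (μ : Measure X)
    (x : X) : Prop :=
  ∀ r : ℝ, 0 < r → ENNReal.ofReal r ≤ ediam (univ : Set X) / ENNReal.ofReal (2 * τ) →
    ENNReal.ofReal γ * μ (ball x r) ≤ μ (ball x (τ * r))

/-- `f : X → [-∞, ∞]` is integrable. -/
def IntegrableFun {X : Type*} [MeasurableSpace X] (μ : Measure X) (f : X → EReal) : Prop :=
  AEMeasurable f μ ∧ ∫⁻ x, (f x).abs ∂μ < ∞

/-- `X` supports a `p`-Poincaré inequality at `x` with constant `C` and dilation `lam`. Since an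
integrable `f` is finite almost everywhere, its integrals are those of `(f y).toReal`. -/
def PoincareAt {X : Type*} [MetricSpace X] [MeasurableSpace X] (p C lam : ℝ) (μ : Measure X)
    (x : X) : Prop :=
  ∀ r : ℝ, 0 < r → ∀ (f : X → EReal) (g : X → ℝ≥0∞), IntegrableFun μ f → IsUpperGradient f g →
    ⨍⁻ y in ball x r, ENNReal.ofReal |(f y).toReal - ⨍ z in ball x r, (f z).toReal ∂μ| ∂μ ≤
      ENNReal.ofReal (C * r) * (⨍⁻ y in ball x (lam * r), g y ^ p ∂μ) ^ (1 / p)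

/-- The lower bound `μ(B_R) / R^p ≤ A cap_p(B_r, B_R)` for `0 < R/2 ≤ r < R ≤ diam X / (2τ)`,
where `B_r = B(x₀, r)`. -/
def ThinAnnulusLowerBound {X : Type*} [MetricSpace X] [MeasurableSpace X] (p τ A : ℝ)
    (μ : Measure X) (x₀ : X) : Prop :=
  ∀ r R : ℝ, 0 < R → R / 2 ≤ r → r < R →
    ENNReal.ofReal R ≤ ediam (univ : Set X) / ENNReal.ofReal (2 * τ) →
    μ (ball x₀ R) / ENNReal.ofReal (R ^ p) ≤
      ENNReal.ofReal A * capacity p μ (ball x₀ r) (ball x₀ R)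

/-- The two-sided bound `cap_p(B_r, B_{2r}) ≃ μ(B_r) r^{-p}`, with comparison constant `A`,
for `0 < r ≤ diam X / (4τ)`. -/
def DoubleBallTwoSidedBound {X : Type*} [MetricSpace X] [MeasurableSpace X] (p τ A : ℝ)
    (μ : Measure X) (x₀ : X) : Prop :=
  ∀ r : ℝ, 0 < r →
    ENNReal.ofReal r ≤ ediam (univ : Set X) / ENNReal.ofReal (4 * τ) →
    capacity p μ (ball x₀ r) (ball x₀ (2 * r)) ≤
        ENNReal.ofReal A * (μ (ball x₀ r) / ENNReal.ofReal (r ^ p)) ∧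
      μ (ball x₀ r) / ENNReal.ofReal (r ^ p) ≤
        ENNReal.ofReal A * capacity p μ (ball x₀ r) (ball x₀ (2 * r))

end

end MetricCapacity

namespace MetricCapacity

/-! The upper bound tests the capacity with the cutoff of slope `1/r` that is `1` on `B_r` and `0`
off `B_{2r}`; doubling absorbs the measure of the larger ball (`capacity_ball_le`).

For the lower bound, let `v` be admissible for `(B_r, B_R)` and apply the Poincaré inequality on
`B_{τR}`. Since `0 ≤ v ≤ 1` and `v = 0` off `B_R`, reverse doubling forces the mean of `v` over
`B_{τR}` to be at most `1/γ`. Hence `v` exceeds its mean by at least `1 - 1/γ` on `B_r`, which by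
doubling fills a fixed fraction of `B_{τR}` (`ofReal_mul_le_setLAverage`). On the other side, an
upper gradient of `v` may be replaced by `0` off `B_R` (`IsUpperGradient.indicator`), so only the
energy in `B_R` remains (`measure_div_le_mul_setLIntegral`). Capacity uses `p`-weak upper gradients
while the Poincaré inequality uses genuine ones; `IsWeakUpperGradient.le_mul_setLIntegral` bridges
the two.

In (b), reverse doubling is derived: the Poincaré inequality makes spheres nonempty
(`PoincareAt.exists_dist_eq`), so the annulus between `B_r` and `B_{τr}` contains a ball of
comparable radius, hence of comparable measure. -/

theorem upperGradientOn_coe_iff {X : Type*} [MetricSpace X] {v : X → ℝ} {g : X → ℝ≥0∞}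
    {γ : ArcCurve X} : UpperGradientOn (fun x => (v x : EReal)) g γ ↔
      ENNReal.ofReal |v (γ.toFun 0) - v (γ.toFun γ.length)| ≤ lineIntegral g γ := by
  rw [UpperGradientOn, ← EReal.coe_sub, EReal.abs_def]

/-! ### Subcurves and reversal of arc-length curves -/

namespace ArcCurve

variable {X : Type*} [MetricSpace X]

theorem lipschitzOnWith (γ : ArcCurve X) : LipschitzOnWith 1 γ.toFun (Icc 0 γ.length) := by
  have key : ∀ x ∈ Icc 0 γ.length, ∀ y ∈ Icc 0 γ.length, x ≤ y →
      edist (γ.toFun x) (γ.toFun y) ≤ edist x y := by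
    intro x hx y hy hxy
    refine (eVariationOn.edist_le γ.toFun (s := Icc 0 γ.length ∩ Icc x y)
      ⟨hx, left_mem_Icc.2 hxy⟩ ⟨hy, right_mem_Icc.2 hxy⟩).trans ?_
    rw [γ.unitSpeed hx hy, edist_comm, edist_dist, Real.dist_eq, abs_of_nonneg (sub_nonneg.2 hxy)]
    simp
  intro x hx y hy
  rw [ENNReal.coe_one, one_mul]
  rcases le_total x y with h | h
  · exact key x hx y hy h
  · rw [edist_comm, edist_comm x]
    exact key y hy x hx h

theorem continuousOn (γ : ArcCurve X) : ContinuousOn γ.toFun (Icc 0 γ.length) :=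
  γ.lipschitzOnWith.continuousOn

/-- The part of a curve up to the parameter `t`. -/
def initial (γ : ArcCurve X) (t : ℝ) (ht : 0 < t) (htl : t ≤ γ.length) : ArcCurve X where
  length := t
  length_pos := ht
  toFun := γ.toFun
  unitSpeed := by
    intro x hx y hy
    rw [← γ.unitSpeed ⟨hx.1, hx.2.trans htl⟩ ⟨hy.1, hy.2.trans htl⟩]
    congr 1
    ext z
    simp only [mem_inter_iff, mem_Icc]
    exact ⟨fun h => ⟨⟨h.1.1, h.1.2.trans htl⟩, h.2⟩, fun h => ⟨⟨h.1.1, h.2.2.trans hy.2⟩, h.2⟩⟩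

/-- The curve traversed backwards. -/
def reverse (γ : ArcCurve X) : ArcCurve X where
  length := γ.length
  length_pos := γ.length_pos
  toFun := fun s => γ.toFun (γ.length - s)
  unitSpeed := by
    intro x hx y hy
    have h := eVariationOn.comp_eq_of_antitoneOn γ.toFun (t := Icc 0 γ.length ∩ Icc x y)
      (fun s => γ.length - s) (fun a _ b _ hab => sub_le_sub_left hab _)
    refine h.trans ?_
    have hx' : γ.length - x ∈ Icc 0 γ.length := ⟨by linarith [hx.2], by linarith [hx.1]⟩
    have hy' : γ.length - y ∈ Icc 0 γ.length := ⟨by linarith [hy.2], by linarith [hy.1]⟩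
    have h2 := γ.unitSpeed hy' hx'
    rw [show γ.length - x - (γ.length - y) = y - x by ring] at h2
    rw [← h2]
    congr 1
    ext z
    simp only [mem_image, mem_inter_iff, mem_Icc]
    constructor
    · rintro ⟨w, ⟨⟨h1, h2⟩, h3, h4⟩, rfl⟩
      exact ⟨⟨by linarith, by linarith⟩, by linarith, by linarith⟩
    · rintro ⟨⟨h1, h2⟩, h3, h4⟩
      exact ⟨γ.length - z, ⟨⟨by linarith, by linarith⟩, by linarith, by linarith⟩, by ring⟩

theorem lineIntegral_reverse (γ : ArcCurve X) (g : X → ℝ≥0∞) :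
    lineIntegral g γ.reverse = lineIntegral g γ := by
  have h := (Measure.measurePreserving_sub_left volume γ.length).setLIntegral_comp_preimage_emb
    (MeasurableEquiv.subLeft γ.length).measurableEmbedding (fun s => g (γ.toFun s))
    (Icc 0 γ.length)
  rw [lineIntegral, lineIntegral, ← h]
  simp [reverse]

end ArcCurve

/-! ### Cutting off upper gradients outside an open set -/

section Cutoff

variable {X : Type*} [MetricSpace X] [MeasurableSpace X]

/-- A curve which starts anywhere and leaves `U` picks up the whole initial value of a function
vanishing outside `U` already within `U`. -/
theorem ofReal_le_lineIntegral_indicator {v : X → ℝ} {h : X → ℝ≥0∞} {U : Set X} (hU : IsOpen U)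
    (hv : ∀ x, 0 ≤ v x) (hvU : ∀ x ∉ U, v x = 0)
    (hh : IsUpperGradient (fun x => (v x : EReal)) h) (γ : ArcCurve X)
    (hγ : ∃ s ∈ Icc 0 γ.length, γ.toFun s ∉ U) :
    ENNReal.ofReal (v (γ.toFun 0)) ≤ lineIntegral (U.indicator h) γ := by
  by_cases h0 : γ.toFun 0 ∈ U
  swap
  · simp [hvU _ h0]
  -- `sInf T` is the first exit time from `U`; it is attained because `Uᶜ` is closed.
  set T : Set ℝ := Icc 0 γ.length ∩ γ.toFun ⁻¹' Uᶜ with hT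
  have hTne : T.Nonempty := hγ
  have hTbdd : BddBelow T := ⟨0, fun s hs => hs.1.1⟩
  have hTcl : IsClosed T :=
    γ.continuousOn.preimage_isClosed_of_isClosed isClosed_Icc hU.isClosed_compl
  have htT : sInf T ∈ T := hTcl.csInf_mem hTne hTbdd
  set t := sInf T
  have ht0 : 0 < t := htT.1.1.lt_of_ne (fun h => htT.2 (h ▸ h0))
  have key := upperGradientOn_coe_iff.1 (hh.2 (γ.initial t ht0 htT.1.2))
  change ENNReal.ofReal |v (γ.toFun 0) - v (γ.toFun t)| ≤ ∫⁻ s in Icc 0 t, h (γ.toFun s) at key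
  rw [hvU _ htT.2, sub_zero, abs_of_nonneg (hv _)] at key
  refine key.trans ?_
  -- At the exit time the curve is already outside `U`, where the indicator vanishes, so this
  -- endpoint is dropped as a null set.
  rw [← setLIntegral_congr (Ico_ae_eq_Icc (a := 0) (b := t))]
  calc ∫⁻ s in Ico 0 t, h (γ.toFun s)
      = ∫⁻ s in Ico 0 t, U.indicator h (γ.toFun s) := by
        refine setLIntegral_congr_fun measurableSet_Ico fun s hs => ?_
        have : γ.toFun s ∈ U := by
          by_contra hsU
          exact (csInf_le hTbdd (show s ∈ T from ⟨⟨hs.1, hs.2.le.trans htT.1.2⟩, hsU⟩)).not_gt hs.2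
        simp [this]
    _ ≤ lineIntegral (U.indicator h) γ :=
        lintegral_mono_set (Ico_subset_Icc_self.trans (Icc_subset_Icc_right htT.1.2))

/-- An upper gradient of a nonnegative function vanishing outside an open set can be cut off
outside that set. -/
theorem IsUpperGradient.indicator [OpensMeasurableSpace X] {v : X → ℝ} {h : X → ℝ≥0∞} {U : Set X}
    (hh : IsUpperGradient (fun x => (v x : EReal)) h) (hU : IsOpen U)
    (hv : ∀ x, 0 ≤ v x) (hvU : ∀ x ∉ U, v x = 0) :
    IsUpperGradient (fun x => (v x : EReal)) (U.indicator h) := by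
  refine ⟨hh.1.indicator hU.measurableSet, fun γ => ?_⟩
  by_cases hγ : ∃ s ∈ Icc 0 γ.length, γ.toFun s ∉ U
  · rw [upperGradientOn_coe_iff]
    have h1 := ofReal_le_lineIntegral_indicator hU hv hvU hh γ hγ
    have h2 := ofReal_le_lineIntegral_indicator hU hv hvU hh γ.reverse (by
      obtain ⟨s, hs, hsU⟩ := hγ
      exact ⟨γ.length - s, ⟨by linarith [hs.2], by simp [ArcCurve.reverse, hs.1]⟩,
        by simpa [ArcCurve.reverse] using hsU⟩)
    rw [γ.lineIntegral_reverse] at h2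
    simp only [ArcCurve.reverse, sub_zero] at h2
    -- For nonnegative values the difference is bounded by the maximum rather than the sum, so the
    -- forward and backward estimates cost no factor `2`.
    have h3 : |v (γ.toFun 0) - v (γ.toFun γ.length)| ≤
        max (v (γ.toFun 0)) (v (γ.toFun γ.length)) :=
      abs_le.2 ⟨by linarith [hv (γ.toFun 0), le_max_right (v (γ.toFun 0)) (v (γ.toFun γ.length))],
        by linarith [hv (γ.toFun γ.length), le_max_left (v (γ.toFun 0)) (v (γ.toFun γ.length))]⟩
    refine (ENNReal.ofReal_le_ofReal h3).trans ?_
    rw [ENNReal.ofReal_max]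
    exact max_le h1 h2
  · push Not at hγ
    refine (hh.2 γ).trans (le_of_eq (setLIntegral_congr_fun measurableSet_Icc fun s hs => ?_))
    simp [hγ s hs]

end Cutoff

/-! ### Upper gradients of cutoff and characteristic functions -/

/-- A Lipschitz function with values in `[0, 1]` varies only where its values lie in `(0, 1)`. -/
theorem ofReal_abs_sub_le_mul_volume {h : ℝ → ℝ} {l : ℝ} {K : NNReal} (hl : 0 ≤ l)
    (hK : LipschitzOnWith K h (Icc 0 l)) (h01 : ∀ s, h s ∈ Icc (0 : ℝ) 1) :
    ENNReal.ofReal |h 0 - h l| ≤ K * volume (Icc 0 l ∩ h ⁻¹' Ioo 0 1) := by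
  have hsub : Ioo (min (h 0) (h l)) (max (h 0) (h l)) ⊆ h '' (Icc 0 l ∩ h ⁻¹' Ioo 0 1) := by
    intro y hy
    have hc : ContinuousOn h (uIcc 0 l) := by rw [uIcc_of_le hl]; exact hK.continuousOn
    obtain ⟨s, hs, rfl⟩ := intermediate_value_uIcc hc (Ioo_subset_Icc_self hy)
    rw [uIcc_of_le hl] at hs
    exact ⟨s, ⟨hs, (le_min (h01 0).1 (h01 l).1).trans_lt hy.1,
      hy.2.trans_le (max_le (h01 0).2 (h01 l).2)⟩, rfl⟩
  calc ENNReal.ofReal |h 0 - h l|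
      = volume (Ioo (min (h 0) (h l)) (max (h 0) (h l))) := by
        rw [Real.volume_Ioo, max_sub_min_eq_abs, abs_sub_comm]
    _ ≤ volume (h '' (Icc 0 l ∩ h ⁻¹' Ioo 0 1)) := measure_mono hsub
    _ ≤ _ := by
        -- On the line, length is one-dimensional Hausdorff measure, which a `K`-Lipschitz map
        -- enlarges at most by the factor `K`.
        have := (hK.mono inter_subset_left).hausdorffMeasure_image_le (d := 1)
          (s := Icc 0 l ∩ h ⁻¹' Ioo 0 1) zero_le_one
        simpa [hausdorffMeasure_real] using this

/-- The upper gradient of a Lipschitz function with values in `[0, 1]`. -/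
theorem isUpperGradient_of_lipschitzWith {X : Type*} [MetricSpace X] [MeasurableSpace X]
    [OpensMeasurableSpace X] {η : X → ℝ} {K : NNReal} (hη : LipschitzWith K η)
    (h01 : ∀ x, η x ∈ Icc (0 : ℝ) 1) :
    IsUpperGradient (fun x => (η x : EReal)) ((η ⁻¹' Ioo 0 1).indicator fun _ => (K : ℝ≥0∞)) := by
  refine ⟨measurable_const.indicator (isOpen_Ioo.preimage hη.continuous).measurableSet,
    fun γ => upperGradientOn_coe_iff.2 ?_⟩
  have hL : LipschitzOnWith K (η ∘ γ.toFun) (Icc 0 γ.length) := by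
    simpa using hη.comp_lipschitzOnWith γ.lipschitzOnWith
  refine (ofReal_abs_sub_le_mul_volume (h := η ∘ γ.toFun) γ.length_pos.le hL
    fun s => h01 _).trans ?_
  set S : Set ℝ := Icc 0 γ.length ∩ η ∘ γ.toFun ⁻¹' Ioo 0 1
  have hS : MeasurableSet S := by
    obtain ⟨u, hu, hue⟩ := continuousOn_iff'.1 hL.continuousOn (Ioo 0 1) isOpen_Ioo
    rw [show S = u ∩ Icc 0 γ.length by rw [← hue, inter_comm]]
    exact hu.measurableSet.inter measurableSet_Icc
  calc (K : ℝ≥0∞) * volume S = ∫⁻ _ in S, (K : ℝ≥0∞) := by rw [setLIntegral_const]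
    _ = ∫⁻ s in S, (η ⁻¹' Ioo 0 1).indicator (fun _ => (K : ℝ≥0∞)) (γ.toFun s) := by
        refine setLIntegral_congr_fun hS fun s hs => ?_
        rw [indicator_of_mem (show γ.toFun s ∈ η ⁻¹' Ioo 0 1 from hs.2)]
    _ ≤ _ := lintegral_mono_set inter_subset_left

/-- The constant `0` is an upper gradient of the characteristic function of a clopen set. -/
theorem isUpperGradient_indicator_isClopen {X : Type*} [MetricSpace X] [MeasurableSpace X]
    {U : Set X} (hU : IsClopen U) :
    IsUpperGradient (fun x => ((U.indicator (fun _ => (1 : ℝ)) x : ℝ) : EReal)) 0 := by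
  refine ⟨measurable_const, fun γ => upperGradientOn_coe_iff.2 ?_⟩
  have hpre : IsPreconnected (γ.toFun '' Icc 0 γ.length) :=
    isPreconnected_Icc.image _ γ.continuousOn
  have h0 : γ.toFun 0 ∈ γ.toFun '' Icc 0 γ.length :=
    mem_image_of_mem _ (left_mem_Icc.2 γ.length_pos.le)
  have hl : γ.toFun γ.length ∈ γ.toFun '' Icc 0 γ.length :=
    mem_image_of_mem _ (right_mem_Icc.2 γ.length_pos.le)
  have hiff : γ.toFun 0 ∈ U ↔ γ.toFun γ.length ∈ U :=
    ⟨fun h => hpre.subset_isClopen hU ⟨_, h0, h⟩ hl, fun h => hpre.subset_isClopen hU ⟨_, hl, h⟩ h0⟩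
  by_cases h : γ.toFun 0 ∈ U
  · simp [h, hiff.1 h]
  · simp [h, show γ.toFun γ.length ∉ U from fun h' => h (hiff.2 h')]

/-! ### From weak to genuine upper gradients -/

/-- Setting the measurable representative to `∞` on a measurable null set gives domination
everywhere. This matters because a curve may run inside a null set. -/
theorem exists_measurable_ge_ae_eq {X : Type*} [MeasurableSpace X] {μ : Measure X} {g : X → ℝ≥0∞}
    (hg : AEMeasurable g μ) : ∃ g' : X → ℝ≥0∞, Measurable g' ∧ g ≤ g' ∧ g' =ᵐ[μ] g := by
  set N := toMeasurable μ {x | g x ≠ hg.mk g x}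
  have hN : μ N = 0 := by rw [measure_toMeasurable]; exact hg.ae_eq_mk
  refine ⟨fun x => hg.mk g x + N.indicator (fun _ => ∞) x,
    hg.measurable_mk.add (measurable_const.indicator (measurableSet_toMeasurable _ _)), ?_, ?_⟩
  · intro x
    by_cases hx : x ∈ N
    · simp [hx]
    · have : g x = hg.mk g x := by
        by_contra h
        exact hx (subset_toMeasurable _ _ h)
      simp [hx, this]
  · filter_upwards [hg.ae_eq_mk, measure_eq_zero_iff_ae_notMem.1 hN] with x hx hxN
    simp [hxN, hx]

/-- On an exceptional curve `ρ` has infinite line integral, and so does any positive multiple of it;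
adding such a multiple to `g` therefore repairs the inequality there. -/
theorem IsUpperGradient.of_weak_add {X : Type*} [MetricSpace X] [MeasurableSpace X]
    {u : X → EReal} {g h ρ : X → ℝ≥0∞} (hh : Measurable h) (hgh : g ≤ h) {c : ℝ≥0∞}
    (hc : c ≠ 0) (hc' : c ≠ ∞) (hρh : ∀ x, c * ρ x ≤ h x)
    (hρ : ∀ γ ∈ {γ | ¬ UpperGradientOn u g γ}, lineIntegral ρ γ = ∞) : IsUpperGradient u h := by
  refine ⟨hh, fun γ => ?_⟩
  by_cases hγ : UpperGradientOn u g γ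
  · exact hγ.trans (lintegral_mono fun s => hgh _)
  · have h1 : c * lineIntegral ρ γ ≤ lineIntegral h γ := by
      rw [lineIntegral, ← lintegral_const_mul' _ _ hc']
      exact lintegral_mono fun s => hρh _
    rw [hρ γ hγ, ENNReal.mul_top hc, top_le_iff] at h1
    rw [UpperGradientOn, h1]
    exact le_top

/-- A bound by the energy of every upper gradient passes to `p`-weak upper gradients. -/
theorem IsWeakUpperGradient.le_mul_setLIntegral {X : Type*} [MetricSpace X] [MeasurableSpace X]
    {p : ℝ} (hp : 1 ≤ p) {μ : Measure X} {u : X → EReal} {g : X → ℝ≥0∞}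
    (hg : IsWeakUpperGradient p μ u g) (hgp : ∫⁻ x, g x ^ p ∂μ < ∞) {Ω : Set X} {a C : ℝ≥0∞}
    (hC : C ≠ ∞) (H : ∀ h, IsUpperGradient u h → a ≤ C * ∫⁻ x in Ω, h x ^ p ∂μ) :
    a ≤ C * ∫⁻ x in Ω, g x ^ p ∂μ := by
  have hp0 : 0 < p := zero_lt_one.trans_le hp
  obtain ⟨g', hg'm, hgg', hg'e⟩ := exists_measurable_ge_ae_eq hg.1
  obtain ⟨ρ, hρm, hρp, hρ⟩ := hg.2
  have hpe : (fun x => g' x ^ p) =ᵐ[μ] fun x => g x ^ p := hg'e.fun_comp (· ^ p)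
  have hg'p : ∫⁻ x, g' x ^ p ∂μ < ∞ := by rwa [lintegral_congr_ae hpe]
  -- Each `g' + c n * ρ` is a genuine upper gradient, and its energy tends to that of `g'` by
  -- dominated convergence with majorant `(g' + ρ) ^ p`.
  set c : ℕ → ℝ≥0∞ := fun n => ((n + 1 : ℕ) : ℝ≥0∞)⁻¹
  have hc1 : ∀ n, c n ≤ 1 := fun n => ENNReal.inv_le_one.2 (by exact_mod_cast Nat.succ_pos n)
  have hc : Filter.Tendsto c Filter.atTop (nhds 0) :=
    ENNReal.tendsto_inv_nat_nhds_zero.comp (Filter.tendsto_add_atTop_nat 1)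
  have hρfin : ∀ᵐ x ∂μ, ρ x < ∞ := by
    filter_upwards [ae_lt_top (hρm.pow_const p) hρp.ne] with x hx
    exact (ENNReal.rpow_lt_top_iff_of_pos hp0).1 hx
  have hlim : Filter.Tendsto (fun n => ∫⁻ x in Ω, (g' x + c n * ρ x) ^ p ∂μ) Filter.atTop
      (nhds (∫⁻ x in Ω, g' x ^ p ∂μ)) := by
    refine tendsto_lintegral_of_dominated_convergence (fun x => (g' x + ρ x) ^ p)
      (fun n => (hg'm.add (hρm.const_mul _)).pow_const p) (fun n => ?_) ?_ ?_
    · refine Filter.Eventually.of_forall fun x => ENNReal.rpow_le_rpow ?_ hp0.le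
      gcongr
      exact mul_le_of_le_one_left' (hc1 n)
    · exact ((setLIntegral_le_lintegral _ _).trans_lt
        (ENNReal.lintegral_rpow_add_lt_top_of_lintegral_rpow_lt_top hg'm.aemeasurable hg'p
          hρp hp)).ne
    · filter_upwards [ae_restrict_of_ae hρfin] with x hx
      have h1 : Filter.Tendsto (fun n => g' x + c n * ρ x) Filter.atTop (nhds (g' x)) := by
        simpa using tendsto_const_nhds.add (ENNReal.Tendsto.mul_const hc (Or.inr hx.ne))
      exact (ENNReal.continuous_rpow_const.tendsto _).comp h1
  rw [← lintegral_congr_ae (ae_restrict_of_ae hpe)]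
  refine ge_of_tendsto (ENNReal.Tendsto.const_mul hlim (Or.inr hC))
    (Filter.Eventually.of_forall fun n => H _ ?_)
  exact IsUpperGradient.of_weak_add (hg'm.add (hρm.const_mul _))
    (fun x => (hgg' x).trans le_self_add) (ENNReal.inv_ne_zero.2 (ENNReal.natCast_ne_top _))
    ((hc1 n).trans_lt ENNReal.one_lt_top).ne (fun x => le_add_self) hρ

variable {X : Type*} [MetricSpace X] [MeasurableSpace X]

/-! ### Doubling, nonempty spheres and reverse doubling -/

theorem DoublingAt.pow {C : ℝ} {μ : Measure X} {x : X} (h : DoublingAt C μ x) (k : ℕ) {r : ℝ}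
    (hr : 0 < r) : μ (ball x (2 ^ k * r)) ≤ ENNReal.ofReal C ^ k * μ (ball x r) := by
  induction k with
  | zero => simp
  | succ k ih =>
    calc μ (ball x (2 ^ (k + 1) * r)) = μ (ball x (2 * (2 ^ k * r))) := by
          rw [pow_succ']; ring_nf
      _ ≤ ENNReal.ofReal C * μ (ball x (2 ^ k * r)) := h _ (by positivity)
      _ ≤ ENNReal.ofReal C * (ENNReal.ofReal C ^ k * μ (ball x r)) := by gcongr
      _ = _ := by rw [pow_succ']; ring

/-- Under a Poincaré inequality at `x`, every sphere around `x` of radius less than the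
circumradius is nonempty. -/
theorem PoincareAt.exists_dist_eq [BorelSpace X] {p CP lam : ℝ} (hp : 0 < p) {μ : Measure X}
    {x : X} (hμ : BallsPosFinite μ) (hP : PoincareAt p CP lam μ x) {s : ℝ} (hs : 0 < s)
    (hne : ∃ y, s ≤ dist y x) : ∃ y, dist y x = s := by
  by_contra! hcon
  obtain ⟨y, hy⟩ := hne
  set U := ball x s
  have hUcl : IsClopen U := by
    refine ⟨?_, isOpen_ball⟩
    have : U = closedBall x s := by
      ext z
      exact ⟨fun h => ball_subset_closedBall h, fun h => lt_of_le_of_ne h (hcon z)⟩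
    rw [this]
    exact isClosed_closedBall
  have hUm : MeasurableSet U := hUcl.isOpen.measurableSet
  set v : X → ℝ := U.indicator fun _ => 1
  have hvm : Measurable v := measurable_const.indicator hUm
  have hint : IntegrableFun μ fun z => (v z : EReal) := by
    refine ⟨hvm.coe_real_ereal.aemeasurable, ?_⟩
    have : ∀ z, ((v z : ℝ) : EReal).abs = U.indicator (fun _ => 1) z := by
      intro z
      rw [EReal.abs_def]
      by_cases hz : z ∈ U <;> simp [v, hz]
    simp_rw [this]
    rw [lintegral_indicator_const hUm, one_mul]
    exact (hμ x s hs).2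
  have hR : 0 < dist y x + 1 := by positivity
  have hsR : s < dist y x + 1 := by linarith
  set B := ball x (dist y x + 1)
  -- An empty sphere makes `U` clopen, so its characteristic function has upper gradient `0` and
  -- must be a.e. constant on `B`; yet it is `1` on `U` and `0` near `y`.
  have key := hP (dist y x + 1) hR _ 0 hint (isUpperGradient_indicator_isClopen hUcl)
  simp only [Pi.zero_apply, EReal.toReal_coe, ENNReal.zero_rpow_of_pos hp, setLAverage_eq,
    lintegral_zero, ENNReal.zero_div, ENNReal.zero_rpow_of_pos (one_div_pos.2 hp), mul_zero,
    nonpos_iff_eq_zero, ENNReal.div_eq_zero_iff, (hμ x _ hR).2.ne, or_false] at key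
  set m := ⨍ z in B, v z ∂μ
  rw [lintegral_eq_zero_iff (by fun_prop)] at key
  have hae : ∀ᵐ z ∂μ, z ∈ B → v z = m := by
    rw [← ae_restrict_iff' measurableSet_ball]
    filter_upwards [key] with z hz
    have : |v z - m| ≤ 0 := by simpa using hz
    exact sub_eq_zero.1 (abs_nonpos_iff.1 this)
  have exists_mem : ∀ V : Set X, 0 < μ V → V ⊆ B → ∃ z ∈ V, v z = m := by
    intro V hV hVB
    by_contra! hV'
    exact hV.ne' (measure_mono_null
      (fun z hz (hzm : z ∈ B → v z = m) => hV' z hz (hzm (hVB hz))) hae)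
  obtain ⟨z, hz, hzm⟩ := exists_mem U (hμ x s hs).1 (ball_subset_ball hsR.le)
  have hy' : y ∈ B \ U := ⟨by simp [B], by simpa [U] using hy⟩
  obtain ⟨ε, hε, hεV⟩ := Metric.isOpen_iff.1 (isOpen_ball.sdiff hUcl.isClosed) y hy'
  obtain ⟨w, hw, hwm⟩ := exists_mem (ball y ε) (hμ y ε hε).1 fun w hw => (hεV hw).1
  rw [show v z = 1 by simp [v, hz]] at hzm
  rw [show v w = 0 by simp [v, (hεV hw).2], ← hzm] at hwm
  exact zero_ne_one hwm

/-- Doubling and a Poincaré inequality imply reverse doubling for every dilation. -/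
theorem reverseDoublingAt_of_doublingAt [BorelSpace X] {p CP lam CD τ : ℝ} (hp : 0 < p)
    (hCD : 0 < CD) (hτ : 1 < τ) {k : ℕ} (hk : (τ + 3) / 2 ≤ 2 ^ k * ((τ - 1) / 2))
    {μ : Measure X} (hμ : BallsPosFinite μ) (hD : ∀ x : X, DoublingAt CD μ x) {x : X}
    (hP : PoincareAt p CP lam μ x) : ReverseDoublingAt (1 + (CD ^ k)⁻¹) τ μ x := by
  intro r hr hrd
  -- The radius midway between `r` and `τ * r`: a ball of radius `ε = (τ - 1) / 2 * r` centred on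
  -- this sphere fits exactly in the annulus.
  set s := (1 + τ) / 2 * r
  have hs : 0 < s := by positivity
  have hsτ : s < τ * r := by
    have : (1 + τ) / 2 < τ := by linarith
    exact mul_lt_mul_of_pos_right this hr
  -- Otherwise the diameter would be at most `2 * s < 2 * τ * r`, against the range of `r`.
  have hne : ∃ y, s ≤ dist y x := by
    by_contra! hcon
    have h1 : ediam (univ : Set X) ≤ ENNReal.ofReal (2 * s) := by
      refine ediam_le fun a _ b _ => ?_
      rw [edist_dist]
      refine ENNReal.ofReal_le_ofReal ((dist_triangle_right a b x).trans ?_)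
      linarith [hcon a, hcon b]
    have h2 : ENNReal.ofReal r * ENNReal.ofReal (2 * τ) ≤ ediam (univ : Set X) :=
      ENNReal.mul_le_of_le_div hrd
    rw [← ENNReal.ofReal_mul hr.le] at h2
    have h3 := (ENNReal.ofReal_le_ofReal_iff (by positivity)).1 (h2.trans h1)
    linarith
  obtain ⟨y, hy⟩ := hP.exists_dist_eq hp hμ hs hne
  set ε := (τ - 1) / 2 * r
  have hε : 0 < ε := mul_pos (by linarith) hr
  have hdisj : Disjoint (ball x r) (ball y ε) := by
    refine ball_disjoint_ball ?_
    rw [dist_comm, hy]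
    exact le_of_eq (by ring)
  have hsub : ball x r ∪ ball y ε ⊆ ball x (τ * r) := by
    refine union_subset (ball_subset_ball (by nlinarith)) (ball_subset_ball' ?_)
    rw [hy]
    exact le_of_eq (by ring)
  have hcover : ball x r ⊆ ball y (2 ^ k * ε) := by
    refine ball_subset_ball' ?_
    rw [dist_comm, hy]
    calc r + s = (τ + 3) / 2 * r := by ring
      _ ≤ 2 ^ k * ((τ - 1) / 2) * r := by gcongr
      _ = 2 ^ k * ε := by ring
  have hsmall : ENNReal.ofReal (CD ^ k)⁻¹ * μ (ball x r) ≤ μ (ball y ε) := by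
    rw [ENNReal.ofReal_inv_of_pos (by positivity), ENNReal.ofReal_pow hCD.le, mul_comm,
      ← div_eq_mul_inv]
    exact ENNReal.div_le_of_le_mul' ((measure_mono hcover).trans ((hD y).pow k hε))
  calc ENNReal.ofReal (1 + (CD ^ k)⁻¹) * μ (ball x r)
      = μ (ball x r) + ENNReal.ofReal (CD ^ k)⁻¹ * μ (ball x r) := by
        rw [ENNReal.ofReal_add zero_le_one (by positivity), add_mul, ENNReal.ofReal_one, one_mul]
    _ ≤ μ (ball x r) + μ (ball y ε) := by gcongr
    _ = μ (ball x r ∪ ball y ε) := (measure_union hdisj measurableSet_ball).symm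
    _ ≤ μ (ball x (τ * r)) := measure_mono hsub

/-! ### Upper bound for the capacity -/

/-- The capacity of a ball is estimated from above by a Lipschitz cutoff function. -/
theorem capacity_ball_le [OpensMeasurableSpace X] {p CD : ℝ} (hp : 0 < p) {μ : Measure X} {x₀ : X}
    (hμ : BallsPosFinite μ) (hD : DoublingAt CD μ x₀) {r : ℝ} (hr : 0 < r) :
    capacity p μ (ball x₀ r) (ball x₀ (2 * r)) ≤
      ENNReal.ofReal CD * (μ (ball x₀ r) / ENNReal.ofReal (r ^ p)) := by
  set K : NNReal := r.toNNReal⁻¹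
  have hKr : (K : ℝ) = r⁻¹ := by simp [K, hr.le]
  set η : X → ℝ := fun x => max 0 (min 1 (2 - dist x x₀ * r⁻¹))
  have hη : LipschitzWith K η := by
    refine LipschitzWith.const_max (LipschitzWith.const_min ?_ 1) 0
    refine LipschitzWith.of_dist_le_mul fun x y => ?_
    rw [Real.dist_eq, show 2 - dist x x₀ * r⁻¹ - (2 - dist y x₀ * r⁻¹) =
      r⁻¹ * -(dist x x₀ - dist y x₀) by ring, abs_mul, abs_neg, hKr, abs_of_pos (inv_pos.2 hr)]
    gcongr
    exact abs_dist_sub_le x y x₀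
  have h01 : ∀ x, η x ∈ Icc (0 : ℝ) 1 := fun x =>
    ⟨le_max_left _ _, max_le zero_le_one (min_le_left _ _)⟩
  have hout : ∀ x ∉ ball x₀ (2 * r), η x = 0 := by
    intro x hx
    rw [mem_ball, not_lt] at hx
    refine max_eq_left ((min_le_right _ _).trans (sub_nonpos.2 ?_))
    rw [← div_eq_mul_inv, le_div_iff₀ hr]
    exact hx
  have hin : ∀ x ∈ ball x₀ r, η x = 1 := by
    intro x hx
    have h1 : dist x x₀ * r⁻¹ ≤ 1 := by
      rw [← div_eq_mul_inv]
      exact (div_le_one hr).2 (mem_ball.1 hx).le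
    have h2 : (1 : ℝ) ≤ 2 - dist x x₀ * r⁻¹ := by linarith
    simp [η, min_eq_left h2]
  have hg := isUpperGradient_of_lipschitzWith hη h01
  set g : X → ℝ≥0∞ := (η ⁻¹' Ioo 0 1).indicator fun _ => (K : ℝ≥0∞)
  have h2r : 0 < 2 * r := by positivity
  have hgp : ∫⁻ x, g x ^ p ∂μ ≤ (K : ℝ≥0∞) ^ p * μ (ball x₀ (2 * r)) := by
    have : ∀ x, g x ^ p ≤ (ball x₀ (2 * r)).indicator (fun _ => (K : ℝ≥0∞) ^ p) x := by
      intro x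
      by_cases hx : x ∈ ball x₀ (2 * r)
      · rw [indicator_of_mem hx]
        exact ENNReal.rpow_le_rpow (indicator_le_self _ _ x) hp.le
      · simp [g, hout x hx, hp]
    refine (lintegral_mono this).trans ?_
    rw [lintegral_indicator_const measurableSet_ball]
  have hgp_lt : ∫⁻ x, g x ^ p ∂μ < ∞ := hgp.trans_lt (ENNReal.mul_lt_top
    (ENNReal.rpow_lt_top_of_nonneg hp.le ENNReal.coe_ne_top) (hμ x₀ _ h2r).2)
  have hηp : ∫⁻ x, ((η x : ℝ) : EReal).abs ^ p ∂μ ≤ μ (ball x₀ (2 * r)) := by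
    have : ∀ x, ((η x : ℝ) : EReal).abs ^ p ≤ (ball x₀ (2 * r)).indicator 1 x := by
      intro x
      rw [EReal.abs_def, abs_of_nonneg (h01 x).1]
      by_cases hx : x ∈ ball x₀ (2 * r)
      · rw [indicator_of_mem hx]
        exact ENNReal.rpow_le_one (ENNReal.ofReal_le_one.2 (h01 x).2) hp.le
      · simp [hout x hx, hp]
    refine (lintegral_mono this).trans ?_
    rw [lintegral_indicator_one measurableSet_ball]
  have hadm : Admissible p μ (ball x₀ r) (ball x₀ (2 * r)) fun x => (η x : EReal) := by
    refine ⟨⟨hη.continuous.measurable.coe_real_ereal.aemeasurable, ?_⟩, fun x _ => ⟨?_, ?_⟩,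
      fun x hx => ?_⟩
    · refine ENNReal.rpow_lt_top_of_nonneg (by positivity) (ENNReal.add_lt_top.2 ⟨?_, ?_⟩).ne
      · exact hηp.trans_lt (hμ x₀ _ h2r).2
      · exact (iInf₂_le g hg).trans_lt hgp_lt
    · by_cases hx : x ∈ ball x₀ r
      · simp [hx, hin x hx]
      · rw [indicator_of_notMem hx]
        exact EReal.coe_nonneg.2 (h01 x).1
    · exact EReal.coe_le_coe_iff.2 (h01 x).2
    · simp [hout x hx]
  have hweak : IsWeakUpperGradient p μ (fun x => (η x : EReal)) g :=
    ⟨hg.1.aemeasurable, 0, measurable_const, by simp [hp], fun γ hγ => absurd (hg.2 γ) hγ⟩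
  calc capacity p μ (ball x₀ r) (ball x₀ (2 * r))
      ≤ ∫⁻ x in ball x₀ (2 * r), g x ^ p ∂μ :=
        (iInf₂_le _ hadm).trans (iInf₂_le g ⟨hweak, hgp_lt⟩)
    _ ≤ (K : ℝ≥0∞) ^ p * μ (ball x₀ (2 * r)) := (setLIntegral_le_lintegral _ _).trans hgp
    _ ≤ (K : ℝ≥0∞) ^ p * (ENNReal.ofReal CD * μ (ball x₀ r)) := by gcongr; exact hD r hr
    _ = _ := by
        have : (K : ℝ≥0∞) ^ p = (ENNReal.ofReal (r ^ p))⁻¹ := by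
          rw [← ENNReal.ofReal_rpow_of_pos hr, ← ENNReal.inv_rpow, ENNReal.coe_inv
            (Real.toNNReal_pos.2 hr).ne']
          rfl
        rw [this, div_eq_mul_inv]
        ring

/-! ### Lower bound for the capacity -/

/-- An admissible function is real-valued with values in `[0, 1]`. -/
theorem Admissible.exists_real {p : ℝ} {μ : Measure X} {E Ω : Set X} {u : X → EReal}
    (hu : Admissible p μ E Ω u) (hE : E ⊆ Ω) : ∃ v : X → ℝ, u = (fun x => (v x : EReal)) ∧
      (∀ x, v x ∈ Icc (0 : ℝ) 1) ∧ (∀ x ∈ E, v x = 1) ∧ ∀ x ∉ Ω, v x = 0 := by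
  have h01 : ∀ x, 0 ≤ u x ∧ u x ≤ 1 := by
    intro x
    by_cases hx : x ∈ Ω
    · exact ⟨(indicator_nonneg (fun _ _ => zero_le_one) x).trans (hu.2.1 x hx).1, (hu.2.1 x hx).2⟩
    · rw [hu.2.2 x hx]
      exact ⟨le_rfl, zero_le_one⟩
  have hcoe : ∀ x, ((u x).toReal : EReal) = u x := fun x =>
    EReal.coe_toReal ((h01 x).2.trans_lt (EReal.coe_lt_top 1)).ne
      ((EReal.bot_lt_coe 0).trans_le (h01 x).1).ne'
  refine ⟨fun x => (u x).toReal, funext fun x => (hcoe x).symm, fun x => ⟨?_, ?_⟩, fun x hx => ?_,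
    fun x hx => ?_⟩
  · exact EReal.toReal_nonneg (h01 x).1
  · have := (h01 x).2
    rw [← hcoe x] at this
    exact_mod_cast this
  · have h1 : u x = 1 := le_antisymm (h01 x).2 (by
      simpa [hx] using (hu.2.1 x (hE hx)).1)
    simp [h1]
  · simp [hu.2.2 x hx]

/-- The mean of a function bounded by `1` and supported in a small part of a set is small, so the
mean oscillation controls the size of the set where the function is `1`. -/
theorem ofReal_mul_le_setLAverage [OpensMeasurableSpace X] {μ : Measure X} {E Ω B : Set X}
    {v : X → ℝ} {γ : ℝ} (hγ : 1 < γ) (hEB : E ⊆ B) (hΩB : Ω ⊆ B) (hE : MeasurableSet E)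
    (hΩ : MeasurableSet Ω) (hB0 : 0 < μ B) (hBfin : μ B < ∞)
    (h01 : ∀ x, v x ∈ Icc (0 : ℝ) 1) (hvE : ∀ x ∈ E, v x = 1) (hvΩ : ∀ x ∉ Ω, v x = 0)
    (hrev : ENNReal.ofReal γ * μ Ω ≤ μ B) :
    ENNReal.ofReal (1 - γ⁻¹) * μ E / μ B ≤
      ⨍⁻ x in B, ENNReal.ofReal |v x - ⨍ z in B, v z ∂μ| ∂μ := by
  set m := ⨍ z in B, v z ∂μ
  have hγ0 : 0 < γ := zero_lt_one.trans hγ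
  have hΩfin : μ Ω < ∞ := (measure_mono hΩB).trans_lt hBfin
  have hBr : 0 < μ.real B := ENNReal.toReal_pos hB0.ne' hBfin.ne
  have hm : m ≤ γ⁻¹ := by
    have h1 : ∫ z in B, v z ∂μ ≤ μ.real Ω := by
      calc ∫ z in B, v z ∂μ ≤ ∫ z in B, Ω.indicator 1 z ∂μ := by
            refine integral_mono_of_nonneg (Filter.Eventually.of_forall fun x => (h01 x).1) ?_
              (Filter.Eventually.of_forall fun x => ?_)
            · refine Integrable.indicator ?_ hΩ
              exact integrableOn_const hBfin.ne
            · by_cases hx : x ∈ Ω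
              · simpa [hx] using (h01 x).2
              · simp [hx, hvΩ x hx]
        _ = μ.real Ω := by
            rw [integral_indicator_one hΩ, measureReal_restrict_apply hΩ,
              inter_eq_self_of_subset_left hΩB]
    have h2 : γ * μ.real Ω ≤ μ.real B := by
      have := ENNReal.toReal_mono hBfin.ne hrev
      rwa [ENNReal.toReal_mul, ENNReal.toReal_ofReal hγ0.le] at this
    rw [show m = (μ.real B)⁻¹ • ∫ z in B, v z ∂μ from setAverage_eq _ _ _, smul_eq_mul,
      inv_mul_le_iff₀ hBr, ← div_eq_mul_inv, le_div_iff₀ hγ0]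
    nlinarith
  rw [setLAverage_eq]
  gcongr
  calc ENNReal.ofReal (1 - γ⁻¹) * μ E = ∫⁻ _ in E, ENNReal.ofReal (1 - γ⁻¹) ∂μ := by
        rw [setLIntegral_const]
    _ ≤ ∫⁻ x in E, ENNReal.ofReal |v x - m| ∂μ := by
        refine setLIntegral_mono' hE fun x hx => ENNReal.ofReal_le_ofReal ?_
        rw [hvE x hx]
        exact (sub_le_sub_left hm 1).trans (le_abs_self _)
    _ ≤ _ := lintegral_mono_set hEB

/-- The Poincaré inequality bounds the energy of every admissible function for a thin annulus
from below. -/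
theorem measure_div_le_mul_setLIntegral [BorelSpace X] {p CP lam CD γ τ : ℝ} (hp : 0 < p)
    (hCD : 0 < CD) (hCP : 0 < CP) (hlam : 1 ≤ lam) (hγ : 1 < γ) (hτ : 1 < τ) {k : ℕ}
    (hk : τ ≤ 2 ^ k) {μ : Measure X} {x₀ : X} (hμ : BallsPosFinite μ)
    (hP : PoincareAt p CP lam μ x₀) (hD : DoublingAt CD μ x₀) {r R : ℝ} (hR : 0 < R)
    (hRr : R / 2 ≤ r) (hrR : r < R)
    (hrev : ENNReal.ofReal γ * μ (ball x₀ R) ≤ μ (ball x₀ (τ * R)))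
    {v : X → ℝ} (hvm : AEMeasurable (fun x => (v x : EReal)) μ) (h01 : ∀ x, v x ∈ Icc (0 : ℝ) 1)
    (hvr : ∀ x ∈ ball x₀ r, v x = 1) (hvR : ∀ x ∉ ball x₀ R, v x = 0) {h : X → ℝ≥0∞}
    (hh : IsUpperGradient (fun x => (v x : EReal)) h) :
    μ (ball x₀ R) / ENNReal.ofReal (R ^ p) ≤
      ENNReal.ofReal ((CP * τ / ((1 - γ⁻¹) / CD ^ (k + 1))) ^ p) *
        ∫⁻ x in ball x₀ R, h x ^ p ∂μ := by
  have hr : 0 < r := by linarith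
  have hτ0 : 0 < τ := zero_lt_one.trans hτ
  have hτR : 0 < τ * R := by positivity
  have hRτR : R ≤ τ * R := by nlinarith
  have hγ1 : 0 < 1 - γ⁻¹ := sub_pos.2 (inv_lt_one_of_one_lt₀ hγ)
  -- Lower bound for the mean oscillation over `B_{τR}`: the excess `1 - γ⁻¹` on `B_r` times the
  -- density of `B_r`. The exponent `k + 1` comes from `τ * R ≤ 2 ^ k * (2 * r)`.
  set c := (1 - γ⁻¹) / CD ^ (k + 1)
  have hc : 0 < c := by positivity
  obtain ⟨hR0, hRfin⟩ := hμ x₀ R hR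
  obtain ⟨ht0, htfin⟩ := hμ x₀ (τ * R) hτR
  have hint : IntegrableFun μ fun x => (v x : EReal) := by
    refine ⟨hvm, lt_of_le_of_lt ?_ hRfin⟩
    rw [← lintegral_indicator_one (measurableSet_ball (x := x₀) (ε := R))]
    refine lintegral_mono fun x => ?_
    rw [EReal.abs_def, abs_of_nonneg (h01 x).1]
    by_cases hx : x ∈ ball x₀ R
    · simpa [indicator_of_mem hx] using (h01 x).2
    · simp [hvR x hx]
  have hg := hh.indicator isOpen_ball (fun x => (h01 x).1) hvR
  have hPI := hP (τ * R) hτR _ _ hint hg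
  simp only [EReal.toReal_coe] at hPI
  have hlow := ofReal_mul_le_setLAverage (μ := μ) hγ
    (ball_subset_ball (x := x₀) (hrR.le.trans hRτR)) (ball_subset_ball hRτR) measurableSet_ball
    measurableSet_ball ht0 htfin h01 hvr hvR hrev
  set I := ∫⁻ x in ball x₀ R, h x ^ p ∂μ
  -- The cut-off gradient lives in `B_R`, so enlarging the ball by `lam` only lowers the average;
  -- `lam` thus drops out of the constant.
  have hupp : ⨍⁻ x in ball x₀ (lam * (τ * R)), (ball x₀ R).indicator h x ^ p ∂μ ≤
      I / μ (ball x₀ R) := by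
    rw [setLAverage_eq]
    have hsub : ball x₀ R ⊆ ball x₀ (lam * (τ * R)) := ball_subset_ball (by nlinarith)
    refine ENNReal.div_le_div ((setLIntegral_le_lintegral _ _).trans (le_of_eq ?_))
      (measure_mono hsub)
    rw [show I = _ from (lintegral_indicator measurableSet_ball _).symm]
    refine lintegral_congr fun x => ?_
    by_cases hx : x ∈ ball x₀ R <;> simp [hx, hp]
  have hcomp : ENNReal.ofReal c ≤ ENNReal.ofReal (1 - γ⁻¹) * μ (ball x₀ r) / μ (ball x₀ (τ * R)) := by
    rw [ENNReal.le_div_iff_mul_le (Or.inl ht0.ne') (Or.inl htfin.ne)]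
    calc ENNReal.ofReal c * μ (ball x₀ (τ * R))
        ≤ ENNReal.ofReal c * (ENNReal.ofReal CD ^ (k + 1) * μ (ball x₀ r)) := by
          gcongr
          refine (measure_mono (ball_subset_ball ?_)).trans (hD.pow (k + 1) hr)
          calc τ * R ≤ 2 ^ k * (2 * r) := by gcongr; linarith
            _ = 2 ^ (k + 1) * r := by ring
      _ = ENNReal.ofReal (1 - γ⁻¹) * μ (ball x₀ r) := by
          rw [← mul_assoc, ← ENNReal.ofReal_pow hCD.le, ← ENNReal.ofReal_mul hc.le,
            div_mul_cancel₀ _ (by positivity)]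
  have hmain : ENNReal.ofReal c ≤ ENNReal.ofReal (CP * (τ * R)) * (I / μ (ball x₀ R)) ^ (1 / p) :=
    (hcomp.trans (hlow.trans hPI)).trans (by gcongr)
  have hpow := ENNReal.rpow_le_rpow hmain hp.le
  rw [ENNReal.mul_rpow_of_nonneg _ _ hp.le, ← ENNReal.rpow_mul, one_div, inv_mul_cancel₀ hp.ne',
    ENNReal.rpow_one, ← mul_div_assoc, ENNReal.le_div_iff_mul_le (Or.inl hR0.ne') (Or.inl hRfin.ne),
    ENNReal.ofReal_rpow_of_pos hc, ENNReal.ofReal_rpow_of_pos (by positivity)] at hpow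
  refine ENNReal.div_le_of_le_mul ?_
  have hcp : 0 < c ^ p := Real.rpow_pos_of_pos hc p
  calc μ (ball x₀ R) = ENNReal.ofReal (c ^ p)⁻¹ * (ENNReal.ofReal (c ^ p) * μ (ball x₀ R)) := by
        rw [← mul_assoc, ← ENNReal.ofReal_mul (by positivity), inv_mul_cancel₀ hcp.ne',
          ENNReal.ofReal_one, one_mul]
    _ ≤ ENNReal.ofReal (c ^ p)⁻¹ * (ENNReal.ofReal ((CP * (τ * R)) ^ p) * I) := by gcongr
    _ = ENNReal.ofReal ((CP * τ / c) ^ p * R ^ p) * I := by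
        rw [← mul_assoc, ← ENNReal.ofReal_mul (by positivity)]
        congr 2
        rw [← mul_assoc CP, Real.mul_rpow (by positivity) hR.le,
          Real.div_rpow (by positivity) hc.le]
        ring
    _ = _ := by
        rw [ENNReal.ofReal_mul (by positivity)]
        ring

theorem thinAnnulusLowerBound_of_reverseDoublingAt [BorelSpace X] {p CP lam CD γ τ : ℝ}
    (hp : 1 ≤ p) (hCD : 0 < CD) (hCP : 0 < CP) (hlam : 1 ≤ lam) (hγ : 1 < γ) (hτ : 1 < τ) {k : ℕ}
    (hk : τ ≤ 2 ^ k) {μ : Measure X} {x₀ : X} (hμ : BallsPosFinite μ)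
    (hP : PoincareAt p CP lam μ x₀) (hD : DoublingAt CD μ x₀)
    (hrev : ReverseDoublingAt γ τ μ x₀) :
    ThinAnnulusLowerBound p τ ((CP * τ / ((1 - γ⁻¹) / CD ^ (k + 1))) ^ p) μ x₀ := by
  intro r R hR hRr hrR hdiam
  have hA : 0 < (CP * τ / ((1 - γ⁻¹) / CD ^ (k + 1))) ^ p := by
    have : 0 < 1 - γ⁻¹ := sub_pos.2 (inv_lt_one_of_one_lt₀ hγ)
    positivity
  -- The constant is moved to the left so that the right side is a bare infimum, then moved back for
  -- each competitor.
  rw [← ENNReal.div_le_iff' (ENNReal.ofReal_pos.2 hA).ne' ENNReal.ofReal_ne_top]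
  refine le_iInf₂ fun u hu => le_iInf₂ fun g hg => ?_
  rw [ENNReal.div_le_iff' (ENNReal.ofReal_pos.2 hA).ne' ENNReal.ofReal_ne_top]
  obtain ⟨v, rfl, h01, hvr, hvR⟩ := hu.exists_real (ball_subset_ball hrR.le)
  exact hg.1.le_mul_setLIntegral hp hg.2 ENNReal.ofReal_ne_top fun h hh =>
    measure_div_le_mul_setLIntegral (zero_lt_one.trans_le hp) hCD hCP hlam hγ hτ hk hμ hP hD hR hRr
      hrR (hrev R hR hdiam) hu.1.1 h01 hvr hvR hh

theorem ThinAnnulusLowerBound.mono {p τ A A' : ℝ} {μ : Measure X} {x₀ : X}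
    (h : ThinAnnulusLowerBound p τ A μ x₀) (hA : A ≤ A') : ThinAnnulusLowerBound p τ A' μ x₀ :=
  fun r R h1 h2 h3 h4 => (h r R h1 h2 h3 h4).trans (by gcongr)

/-- The lower half is the thin annulus bound with `R = 2 * r`; the factor `2 ^ p` comes from `R ^
p`. -/
theorem ThinAnnulusLowerBound.doubleBallTwoSidedBound [OpensMeasurableSpace X] {p τ A A' CD : ℝ}
    (hp : 0 < p) (hτ : 0 < τ) {μ : Measure X} {x₀ : X} (h : ThinAnnulusLowerBound p τ A μ x₀)
    (hμ : BallsPosFinite μ) (hD : DoublingAt CD μ x₀) (hA : 2 ^ p * A ≤ A') (hCD : CD ≤ A') :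
    DoubleBallTwoSidedBound p τ A' μ x₀ := by
  intro r hr hdiam
  refine ⟨(capacity_ball_le hp hμ hD hr).trans (by gcongr), ?_⟩
  have h2 : ENNReal.ofReal (2 * r) ≤ ediam (univ : Set X) / ENNReal.ofReal (2 * τ) := by
    have h0 : ENNReal.ofReal (4 * τ) = ENNReal.ofReal 2 * ENNReal.ofReal (2 * τ) := by
      rw [← ENNReal.ofReal_mul zero_le_two]
      ring_nf
    have hpos : 0 < ENNReal.ofReal (4 * τ) := ENNReal.ofReal_pos.2 (by positivity)
    have hpos' : 0 < ENNReal.ofReal (2 * τ) := ENNReal.ofReal_pos.2 (by positivity)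
    rw [ENNReal.le_div_iff_mul_le (Or.inl hpos.ne') (Or.inl ENNReal.ofReal_ne_top), h0] at hdiam
    rw [ENNReal.le_div_iff_mul_le (Or.inl hpos'.ne') (Or.inl ENNReal.ofReal_ne_top),
      ENNReal.ofReal_mul zero_le_two]
    exact (le_of_eq (by ring)).trans hdiam
  have key := h r (2 * r) (by positivity) (by linarith) (by linarith) h2
  have h2p : (0 : ℝ) < 2 ^ p := by positivity
  calc μ (ball x₀ r) / ENNReal.ofReal (r ^ p)
      = ENNReal.ofReal (2 ^ p) * (μ (ball x₀ r) / ENNReal.ofReal ((2 * r) ^ p)) := by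
        rw [Real.mul_rpow zero_le_two hr.le, ENNReal.ofReal_mul h2p.le, ← mul_div_assoc,
          ENNReal.mul_div_mul_left _ _ (ENNReal.ofReal_pos.2 h2p).ne' ENNReal.ofReal_ne_top]
    _ ≤ ENNReal.ofReal (2 ^ p) * (μ (ball x₀ (2 * r)) / ENNReal.ofReal ((2 * r) ^ p)) := by
        gcongr
        linarith
    _ ≤ ENNReal.ofReal (2 ^ p) * (ENNReal.ofReal A * capacity p μ (ball x₀ r) (ball x₀ (2 * r))) := by
        gcongr
    _ = ENNReal.ofReal (2 ^ p * A) * capacity p μ (ball x₀ r) (ball x₀ (2 * r)) := by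
        rw [ENNReal.ofReal_mul h2p.le, mul_assoc]
    _ ≤ _ := by gcongr

/-! ### Choice of constants and conclusion -/

/-- Both capacity estimates at a point where `μ` is doubling and reverse-doubling. -/
theorem exists_capacity_bounds {p CD CP lam γ τ : ℝ} (hp : 1 ≤ p) (hCD : 0 < CD) (hCP : 0 < CP)
    (hlam : 1 ≤ lam) (hγ : 1 < γ) (hτ : 1 < τ) : ∃ A : ℝ, 0 < A ∧
      ∀ (X : Type*) [MetricSpace X] [MeasurableSpace X] [BorelSpace X] (μ : Measure X) (x₀ : X),
        BallsPosFinite μ → PoincareAt p CP lam μ x₀ → DoublingAt CD μ x₀ →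
          ReverseDoublingAt γ τ μ x₀ →
            ThinAnnulusLowerBound p τ A μ x₀ ∧ DoubleBallTwoSidedBound p τ A μ x₀ := by
  obtain ⟨k, hk⟩ := pow_unbounded_of_one_lt τ one_lt_two
  set A := (CP * τ / ((1 - γ⁻¹) / CD ^ (k + 1))) ^ p
  have hA : 0 ≤ A := by
    have : 0 < 1 - γ⁻¹ := sub_pos.2 (inv_lt_one_of_one_lt₀ hγ)
    positivity
  have hA2 : A ≤ 2 ^ p * A :=
    le_mul_of_one_le_left hA (Real.one_le_rpow one_le_two (zero_le_one.trans hp))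
  refine ⟨2 ^ p * A + CD, by positivity, fun X _ _ _ μ x₀ hμ hP hD hrev => ?_⟩
  have h := thinAnnulusLowerBound_of_reverseDoublingAt hp hCD hCP hlam hγ hτ hk.le hμ hP hD hrev
  change ThinAnnulusLowerBound p τ A μ x₀ at h
  exact ⟨h.mono (by linarith), h.doubleBallTwoSidedBound (zero_lt_one.trans_le hp)
    (zero_lt_one.trans hτ) hμ hD (by linarith) (le_add_of_nonneg_left (by positivity))⟩

end MetricCapacity

theorem mainTheorem5 (p : ℝ) (hp : 1 ≤ p) :
    (∀ CD CP lam γ τ : ℝ, 0 < CD → 0 < CP → 1 ≤ lam → 1 < γ → 1 < τ →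
      ∃ A : ℝ, 0 < A ∧
        ∀ (X : Type*) [MetricSpace X] [MeasurableSpace X] [BorelSpace X] (μ : Measure X) (x₀ : X),
          MetricCapacity.BallsPosFinite μ →
          MetricCapacity.PoincareAt p CP lam μ x₀ →
          MetricCapacity.DoublingAt CD μ x₀ →
          MetricCapacity.ReverseDoublingAt γ τ μ x₀ →
          MetricCapacity.ThinAnnulusLowerBound p τ A μ x₀ ∧
            MetricCapacity.DoubleBallTwoSidedBound p τ A μ x₀) ∧
    (∀ CD CP lam τ : ℝ, 0 < CD → 0 < CP → 1 ≤ lam → 1 < τ →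
      ∃ A : ℝ, 0 < A ∧
        ∀ (X : Type*) [MetricSpace X] [MeasurableSpace X] [BorelSpace X] (μ : Measure X),
          MetricCapacity.BallsPosFinite μ →
          (∀ x : X, MetricCapacity.PoincareAt p CP lam μ x) →
          (∀ x : X, MetricCapacity.DoublingAt CD μ x) →
          ∀ x₀ : X,
            MetricCapacity.ThinAnnulusLowerBound p τ A μ x₀ ∧
              MetricCapacity.DoubleBallTwoSidedBound p τ A μ x₀) := by
  refine ⟨fun CD CP lam γ τ hCD hCP hlam hγ hτ =>
    MetricCapacity.exists_capacity_bounds hp hCD hCP hlam hγ hτ,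
    fun CD CP lam τ hCD hCP hlam hτ => ?_⟩
  -- This `k` depends on `τ` alone, so the reverse-doubling constant `1 + (CD ^ k)⁻¹` depends only
  -- on `CD` and `τ` and is uniform in the point.
  obtain ⟨k, hk⟩ := pow_unbounded_of_one_lt ((τ + 3) / 2 / ((τ - 1) / 2)) one_lt_two
  rw [div_lt_iff₀ (by linarith)] at hk
  obtain ⟨A, hA, h⟩ := MetricCapacity.exists_capacity_bounds (p := p) (γ := 1 + (CD ^ k)⁻¹) hp hCD
    hCP hlam (lt_add_of_pos_right 1 (by positivity)) hτ
  exact ⟨A, hA, fun X _ _ _ μ hμ hP hD x₀ => h X μ x₀ hμ (hP x₀) (hD x₀)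
    (MetricCapacity.reverseDoublingAt_of_doublingAt (zero_lt_one.trans_le hp) hCD hτ hk.le hμ hD
      (hP x₀))⟩
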